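/- Let $G=(V,E)$ be a finite directed metric graph (loops and parallel edges allowed) with at least one edge; the edge $e$ has passage time $t(e)>0$. Assume that $G$ is a one-way Sperner graph with source $s$: $G$ is strongly connected and consists of a spanning tree directed away from the root $s$ together with further edges, all of which end at $s$. Assume that the numbers $t(e)$, $e\in E$, are linearly independent over $\mathbb{Q}$. A point starts at $s$ at time $0$ and moves along the edges in their direction, passing $e$ in time $t(e)$; at each vertex $v$ it chooses the next edge at random, independently of the past, among the edges going out of $v$, each with a fixed non-zero probability. Let $N(T)$ be the number of points of the metric graph (vertices or inner points of edges) at which the moving point is at time $T$ with non-zero probability. Let $c_1,\dots,c_\beta$ be the elementary cycles of $G$ (closed directed routes without repeated vertices, up to the choice of the starting vertex), and let $t(c_j)$ be the sum of the passage times of the edges of $c_j$. Then $N(T)$ is finite for every $T$, and $$N(T)\sim\frac{T^{\beta-1}}{(\beta-1)!}\cdot\frac{\sum_{e\in E}t(e)}{\prod_{j=1}^{\beta}t(c_j)}\qquad\text{as } T\to\infty .$$ -/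

import Mathlib

open MeasureTheory Filter Asymptotics
open scoped Nat ENNReal

/-- A directed metric graph with vertices `V` and edges `E` (loops and parallel edges are allowed);
`len e` is the length, i.e. the passage time, of the edge `e`. -/
structure MetricDigraph (V E : Type*) where
  src : E → V
  tgt : E → V
  len : E → ℝ
  len_pos : ∀ e, 0 < len e

namespace MetricDigraph

variable {V E : Type*}

/-- `G.IsRoute u p v`: the list of edges `p` is a directed route from `u` to `v`. -/
def IsRoute (G : MetricDigraph V E) : V → List E → V → Prop
  | u, [], v => u = v
  | u, e :: p, v => G.src e = u ∧ G.IsRoute (G.tgt e) p v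

def IsStronglyConnected (G : MetricDigraph V E) : Prop :=
  ∀ u v : V, ∃ p : List E, G.IsRoute u p v

/-- The edges in `F` form a spanning tree directed away from the root `s`:
exactly one directed route in `F` leads from `s` to any given vertex. -/
def IsOutTree (G : MetricDigraph V E) (s : V) (F : Set E) : Prop :=
  ∀ v : V, ∃! p : List E, G.IsRoute s p v ∧ ∀ e ∈ p, e ∈ F

/-- One-way Sperner graphs with source `s`: strongly connected, and made of a spanning tree
directed away from `s` together with further edges that all lead to `s`. -/
def IsOneWaySperner (G : MetricDigraph V E) (s : V) : Prop :=
  G.IsStronglyConnected ∧ ∃ F : Set E, G.IsOutTree s F ∧ ∀ e, e ∉ F → G.tgt e = s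

/-- Elementary cycles: nonempty closed directed routes that visit no vertex twice,
up to the choice of the starting vertex. -/
def elementaryCycles (G : MetricDigraph V E) : Set (Cycle E) :=
  {c | ∃ (v : V) (p : List E),
    p ≠ [] ∧ G.IsRoute v p v ∧ (p.map G.src).Nodup ∧ c = (p : Cycle E)}

theorem elementaryCycles_finite [Finite E] (G : MetricDigraph V E) :
    G.elementaryCycles.Finite := by
  classical
  have := Fintype.ofFinite E
  have h : Finite {c : Cycle E // c.Nodup} := inferInstance
  refine Set.Finite.subset (s := {c : Cycle E | c.Nodup}) h ?_
  rintro c ⟨v, p, -, -, hp, rfl⟩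
  exact hp.of_map

noncomputable section

def cycleFinset [Finite E] (G : MetricDigraph V E) : Finset (Cycle E) :=
  G.elementaryCycles_finite.toFinset

/-- The passage time of a cycle: the sum of the passage times of its edges. -/
def cycleLen (G : MetricDigraph V E) (c : Cycle E) : ℝ :=
  (c.toMultiset.map G.len).sum

/-- The points of the metric graph: its vertices, and on every edge `e` the points at distance
`x` from the beginning of `e`, where `0 < x < len e`. -/
inductive Point (G : MetricDigraph V E) : Type _
  | vertex (v : V) : Point G
  | inner (e : E) (x : Set.Ioo (0 : ℝ) (G.len e)) : Point G

/-- The time at which a point that passes the edges `a 0, a 1, …` in this order enters `a n`. -/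
def entryTime (G : MetricDigraph V E) (a : ℕ → E) (n : ℕ) : ℝ :=
  ∑ i ∈ Finset.range n, G.len (a i)

/-- A point that moves along the edges `a 0, a 1, …`, starting at time `0`, is at `x` at time
`T`. -/
def IsAt (G : MetricDigraph V E) (a : ℕ → E) (T : ℝ) : G.Point → Prop
  | .vertex v => ∃ n, G.entryTime a n = T ∧ G.src (a n) = v
  | .inner e x => ∃ n, a n = e ∧ G.entryTime a n + x = T

/-- `X n` is the `n`-th edge of a random walk started at `s`: at the vertex `v` the next edge is
`e` with probability `q v e`, independently of the past, where `q v e` is non-zero exactly for the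
edges `e` going out of `v`. -/
structure IsRandomWalk (G : MetricDigraph V E) (s : V) (q : V → PMF E)
    {Ω : Type*} [MeasurableSpace Ω] (μ : Measure Ω) (X : ℕ → Ω → E) : Prop where
  ne_zero_iff : ∀ v e, q v e ≠ 0 ↔ G.src e = v
  measurable : ∀ n e, MeasurableSet {ω | X n ω = e}
  init : ∀ e, μ {ω | X 0 ω = e} = q s e
  step : ∀ (n : ℕ) (a : ℕ → E),
    μ {ω | ∀ i ≤ n + 1, X i ω = a i} =
      μ {ω | ∀ i ≤ n, X i ω = a i} * q (G.tgt (a n)) (a (n + 1))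

/-- The possible endpoints at time `T`: the points of the metric graph at which the walk is at
time `T` with non-zero probability. -/
def endpoints (G : MetricDigraph V E) {Ω : Type*} [MeasurableSpace Ω] (μ : Measure Ω)
    (X : ℕ → Ω → E) (T : ℝ) : Set G.Point :=
  {x | 0 < μ {ω | G.IsAt (fun n => X n ω) T x}}

end

end MetricDigraph

/-! ### Lattice points in a simplex -/

section LatticePoints

variable {ι : Type*}

/-! An edge outside the tree `F` leads back to `s`, so a route from `s` to `v` consists of turns
"tree path to the source of a back edge `e`, then `e`" and a final tree path to `v`. The turns may
be taken in any number and order. Hence the passage times to `v` are exactly the sums `∑ n e *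
backTime e + depth v` with natural `n e`, and the turns are the elementary cycles, one for each back
edge (`exists_route_iff`, `cycleFinset_eq`). Rational independence of the lengths makes distinct `n`
give distinct times.

Let `L T` count the `n` with `∑ n e * backTime e ≤ T`. The occupied points of an edge `e`, its start
included and its end excluded, correspond to the `n` whose sum lies in a window of length `len e`,
so their number is an increment of `L` (`ncard_edgePart_endpoints`).

For `β ≥ 2`, two cycle times are incommensurable, and `L (T + h) - L T` grows like `c * h * T ^ (β -
1)` for every real `h`, where `c` is the inverse of `(β - 1)!` times the product of the cycle times
(`tendsto_latticeCount_increment`). Summing over the edges gives the claim; vertices counted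
repeatedly cost at most `|E|`, which is negligible. For `β = 1` this error would matter, but then
each vertex has one outgoing edge and the count telescopes to exactly 1. -/

/-- The lattice points `n ≥ 0` supported on `s` with `∑ n i * t i ≤ T`. -/
def latticeSimplex (s : Finset ι) (t : ι → ℝ) (T : ℝ) : Set (ι → ℕ) :=
  {n | (∀ i ∉ s, n i = 0) ∧ ∑ i ∈ s, (n i : ℝ) * t i ≤ T}

/-- The number of lattice points in `latticeSimplex s t T`. -/
noncomputable def latticeCount (s : Finset ι) (t : ι → ℝ) (T : ℝ) : ℝ :=
  ((latticeSimplex s t T).ncard : ℝ)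

variable {s : Finset ι} {t : ι → ℝ} {T : ℝ}

theorem latticeSimplex_finite [Finite ι] (ht : ∀ i, 0 < t i) : (latticeSimplex s t T).Finite := by
  classical
  have := Fintype.ofFinite ι
  refine (Set.finite_Icc (0 : ι → ℕ) (fun i => ⌊T / t i⌋₊)).subset ?_
  rintro n ⟨h0, hn⟩
  refine ⟨fun i => Nat.zero_le _, fun i => ?_⟩
  by_cases hi : i ∈ s
  · apply Nat.le_floor
    rw [le_div_iff₀ (ht i)]
    refine le_trans ?_ hn
    exact Finset.single_le_sum (f := fun i => (n i : ℝ) * t i)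
      (fun j _ => mul_nonneg (Nat.cast_nonneg _) (ht j).le) hi
  · simp [h0 i hi]

theorem latticeSimplex_mono {T' : ℝ} (h : T ≤ T') :
    latticeSimplex s t T ⊆ latticeSimplex s t T' :=
  fun _ hn => ⟨hn.1, hn.2.trans h⟩

theorem latticeCount_mono [Finite ι] (ht : ∀ i, 0 < t i) : Monotone (latticeCount s t) := by
  intro T T' h
  exact Nat.cast_le.2 (Set.ncard_le_ncard (latticeSimplex_mono h) (latticeSimplex_finite ht))

theorem latticeCount_of_neg (ht : ∀ i, 0 < t i) (hT : T < 0) : latticeCount s t T = 0 := by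
  have : latticeSimplex s t T = ∅ := by
    refine Set.eq_empty_of_forall_notMem fun n hn => ?_
    have : 0 ≤ ∑ i ∈ s, (n i : ℝ) * t i :=
      Finset.sum_nonneg fun j _ => mul_nonneg (Nat.cast_nonneg _) (ht j).le
    linarith [hn.2]
  simp [latticeCount, this]

theorem latticeCount_empty (hT : 0 ≤ T) : latticeCount (∅ : Finset ι) t T = 1 := by
  have : latticeSimplex ∅ t T = {0} := by
    ext n
    simp [latticeSimplex, hT, funext_iff]
  simp [latticeCount, this]

/-- Split by whether `n j` is zero; if it is not, lower it by one. -/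
theorem latticeCount_insert [Finite ι] [DecidableEq ι] (ht : ∀ i, 0 < t i) {j : ι} (hj : j ∉ s) :
    latticeCount (insert j s) t T =
      latticeCount (insert j s) t (T - t j) + latticeCount s t T := by
  have hinj : Function.Injective (fun n : ι → ℕ => n + Pi.single j 1) :=
    add_left_injective _
  have hsum : ∀ n : ι → ℕ, ∑ i ∈ s, (((n + Pi.single j 1 : ι → ℕ) i : ℕ) : ℝ) * t i =
      ∑ i ∈ s, (n i : ℝ) * t i := by
    intro n
    refine Finset.sum_congr rfl fun i hi => ?_
    have : i ≠ j := fun h => hj (h ▸ hi)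
    simp [this]
  have hunion : latticeSimplex (insert j s) t T =
      (fun n : ι → ℕ => n + Pi.single j 1) '' latticeSimplex (insert j s) t (T - t j) ∪
        latticeSimplex s t T := by
    ext n
    constructor
    · rintro ⟨h0, hn⟩
      rw [Finset.sum_insert hj] at hn
      rcases Nat.eq_zero_or_pos (n j) with hz | hp
      · right
        refine ⟨fun i hi => ?_, by simpa [hz] using hn⟩
        by_cases hij : i = j
        · rw [hij, hz]
        · exact h0 i (by simp [hij, hi])
      · left
        have hdec : (n - Pi.single j 1 : ι → ℕ) + Pi.single j 1 = n := by
          funext i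
          by_cases hij : i = j
          · subst hij; simp; omega
          · simp [hij]
        refine ⟨n - Pi.single j 1, ⟨fun i hi => ?_, ?_⟩, hdec⟩
        · simp [h0 i hi]
        · rw [Finset.sum_insert hj, ← hsum, hdec]
          have : ((n - Pi.single j 1 : ι → ℕ) j : ℝ) = n j - 1 := by
            simp [Nat.cast_sub hp]
          rw [this]; linarith
    · rintro (⟨m, ⟨h0, hm⟩, rfl⟩ | ⟨h0, hn⟩)
      · refine ⟨fun i hi => ?_, ?_⟩
        · have : i ≠ j := fun h => hi (by simp [h])
          simp [this, h0 i hi]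
        · rw [Finset.sum_insert hj] at hm ⊢
          dsimp only
          rw [hsum]
          have : (((m + Pi.single j 1 : ι → ℕ) j : ℕ) : ℝ) = m j + 1 := by simp
          rw [this]; linarith
      · refine ⟨fun i hi => h0 i fun h => hi (by simp [h]), ?_⟩
        rw [Finset.sum_insert hj, h0 j hj]
        simpa using hn
  have hdisj : Disjoint
      ((fun n : ι → ℕ => n + Pi.single j 1) '' latticeSimplex (insert j s) t (T - t j))
      (latticeSimplex s t T) := by
    rw [Set.disjoint_left]
    rintro _ ⟨m, -, rfl⟩ hn
    simpa using hn.1 j hj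
  unfold latticeCount
  rw [hunion, Set.ncard_union_eq hdisj ((latticeSimplex_finite ht).image _)
    (latticeSimplex_finite ht), Set.ncard_image_of_injective _ hinj]
  push_cast; rfl

/-- This and the next inequality carry the recursion `latticeCount_insert` over to volumes, as upper
and lower bound. -/
theorem pow_succ_add_le_add_pow {y u : ℝ} (hy : 0 ≤ y) (hu : 0 ≤ u) (k : ℕ) :
    y ^ (k + 1) + (k + 1) * u * y ^ k ≤ (y + u) ^ (k + 1) := by
  induction k with
  | zero => simp
  | succ k ih =>
    have h := mul_le_mul_of_nonneg_right ih (add_nonneg hy hu)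
    have : 0 ≤ (k + 1) * u * y ^ k * u := by positivity
    rw [pow_succ (y + u) (k + 1)]
    refine le_trans ?_ h
    push_cast
    have e : y ^ (k + 1 + 1) + (↑k + 1 + 1) * u * y ^ (k + 1) + (↑k + 1) * u * y ^ k * u
      = (y ^ (k + 1) + (↑k + 1) * u * y ^ k) * (y + u) := by ring
    linarith

theorem pow_succ_le_add_sub_pow {y u : ℝ} (hu : 0 ≤ u) (huy : u ≤ y) (k : ℕ) :
    y ^ (k + 1) ≤ (y - u) ^ (k + 1) + (k + 1) * u * y ^ k := by
  induction k with
  | zero => simp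
  | succ k ih =>
    have hy : 0 ≤ y := hu.trans huy
    have h := mul_le_mul_of_nonneg_right ih hy
    have h2 : (y - u) ^ (k + 1) ≤ y ^ (k + 1) :=
      pow_le_pow_left₀ (by linarith) (by linarith) _
    have h3 := mul_le_mul_of_nonneg_right h2 hu
    push_cast
    have e1 : y ^ (k + 1 + 1) = y ^ (k + 1) * y := pow_succ _ _
    have e2 : (y - u) ^ (k + 1 + 1) = (y - u) ^ (k + 1) * y - (y - u) ^ (k + 1) * u := by ring
    have e3 : ((y - u) ^ (k + 1) + (k + 1) * u * y ^ k) * y =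
      (y - u) ^ (k + 1) * y + (k + 1) * u * y ^ (k + 1) := by ring
    have e4 : ((k : ℝ) + 1 + 1) * u * y ^ (k + 1) =
      (k + 1) * u * y ^ (k + 1) + y ^ (k + 1) * u := by ring
    linarith

/-- Volume of the simplex `∑ x i * t i ≤ T`, `x ≥ 0`, with coordinates in `s`. -/
noncomputable def simplexVolume (s : Finset ι) (t : ι → ℝ) (T : ℝ) : ℝ :=
  T ^ s.card / (s.card ! * ∏ i ∈ s, t i)

theorem simplexVolume_insert [DecidableEq ι] {j : ι} (hj : j ∉ s) :
    simplexVolume (insert j s) t T =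
      T ^ (s.card + 1) / ((s.card + 1) * t j * (s.card ! * ∏ i ∈ s, t i)) := by
  rw [simplexVolume, Finset.card_insert_of_notMem hj, Finset.prod_insert hj, Nat.factorial_succ]
  push_cast
  congr 1
  ring

theorem simplexVolume_eq_mul_div {j : ι} (htj : 0 < t j) :
    simplexVolume s t T =
      ((s.card + 1) * t j * T ^ s.card) / ((s.card + 1) * t j * (s.card ! * ∏ i ∈ s, t i)) := by
  rw [simplexVolume, mul_div_mul_left]
  positivity

theorem latticeCount_le [Finite ι] (ht : ∀ i, 0 < t i) (s : Finset ι) :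
    ∀ T, 0 ≤ T → latticeCount s t T ≤ simplexVolume s t (T + ∑ i ∈ s, t i) := by
  classical
  induction s using Finset.induction_on with
  | empty => intro T hT; simp [latticeCount_empty hT, simplexVolume]
  | insert j s hj ih =>
    have hP : 0 < ∏ i ∈ s, t i := Finset.prod_pos fun i _ => ht i
    have hS : 0 ≤ ∑ i ∈ s, t i := Finset.sum_nonneg fun i _ => (ht i).le
    -- Induction on the number of steps of size `t j`. Starting at `-t j` keeps `T - t j` in range
    -- for all `T ≥ 0`; for negative `T` the count is 0 and the enlarged volume is still
    -- nonnegative.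
    have key : ∀ N : ℕ, ∀ T, -t j ≤ T → T < N * t j →
        latticeCount (insert j s) t T ≤
          simplexVolume (insert j s) t (T + ∑ i ∈ insert j s, t i) := by
      intro N
      have hneg : ∀ T, -t j ≤ T → T < 0 → latticeCount (insert j s) t T ≤
          simplexVolume (insert j s) t (T + ∑ i ∈ insert j s, t i) := by
        intro T hT hT0
        rw [latticeCount_of_neg ht hT0, simplexVolume_insert hj, Finset.sum_insert hj]
        have : 0 ≤ T + (t j + ∑ i ∈ s, t i) := by linarith
        have := ht j
        positivity
      induction N with
      | zero => intro T hT hTN; exact hneg T hT (by simpa using hTN)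
      | succ N ihN =>
        intro T hT hTN
        rcases lt_or_ge T 0 with h0 | h0
        · exact hneg T hT h0
        · have h1 := ihN (T - t j) (by linarith) (by push_cast at hTN; linarith)
          have h2 := ih T h0
          rw [latticeCount_insert ht hj]
          refine (add_le_add h1 h2).trans ?_
          rw [simplexVolume_insert hj, simplexVolume_insert hj, simplexVolume_eq_mul_div (ht j),
            ← add_div, Finset.sum_insert hj]
          have := ht j
          have hk := pow_succ_add_le_add_pow (y := T + ∑ i ∈ s, t i) (u := t j) (by linarith)
            this.le s.card
          refine div_le_div_of_nonneg_right ?_ (by positivity)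
          rwa [← add_assoc, sub_add_cancel, add_comm (t j), ← add_assoc]
    intro T hT
    obtain ⟨N, hN⟩ := exists_nat_gt (T / t j)
    exact key N T (by linarith [ht j]) ((div_lt_iff₀ (ht j)).1 hN)

theorem le_latticeCount [Finite ι] (ht : ∀ i, 0 < t i) (s : Finset ι) :
    ∀ T, 0 ≤ T → simplexVolume s t T ≤ latticeCount s t T := by
  classical
  induction s using Finset.induction_on with
  | empty => intro T hT; simp [latticeCount_empty hT, simplexVolume]
  | insert j s hj ih =>
    have hP : 0 < ∏ i ∈ s, t i := Finset.prod_pos fun i _ => ht i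
    have htj := ht j
    have key : ∀ N : ℕ, ∀ T, 0 ≤ T → T < N * t j →
        simplexVolume (insert j s) t T ≤ latticeCount (insert j s) t T := by
      intro N
      induction N with
      | zero => intro T hT hTN; simp at hTN; linarith
      | succ N ihN =>
        intro T hT hTN
        have h2 := ih T hT
        rw [latticeCount_insert ht hj]
        rw [simplexVolume_eq_mul_div htj] at h2
        -- Below `t j` only the slice `n j = 0` remains, and `T ≤ t j` makes it large enough.
        rcases lt_or_ge T (t j) with h0 | h0
        · rw [latticeCount_of_neg ht (by linarith : T - t j < 0), zero_add]
          refine le_trans ?_ h2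
          rw [simplexVolume_insert hj]
          refine div_le_div_of_nonneg_right ?_ (by positivity)
          rw [pow_succ, mul_comm]
          refine mul_le_mul_of_nonneg_right ?_ (by positivity)
          nlinarith [(Nat.cast_nonneg s.card : (0 : ℝ) ≤ s.card)]
        · have h1 := ihN (T - t j) (by linarith) (by push_cast at hTN; linarith)
          refine le_trans ?_ (add_le_add h1 h2)
          rw [simplexVolume_insert hj, simplexVolume_insert hj, ← add_div]
          refine div_le_div_of_nonneg_right ?_ (by positivity)
          exact pow_succ_le_add_sub_pow htj.le h0 s.card
    intro T hT
    obtain ⟨N, hN⟩ := exists_nat_gt (T / t j)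
    exact key N T hT ((div_lt_iff₀ (ht j)).1 hN)

theorem tendsto_add_div_self (h : ℝ) :
    Tendsto (fun T : ℝ => (T + h) / T) atTop (nhds 1) := by
  have h1 : Tendsto (fun T : ℝ => 1 + h / T) atTop (nhds (1 + 0)) :=
    tendsto_const_nhds.add (tendsto_const_nhds.div_atTop tendsto_id)
  rw [add_zero] at h1
  refine h1.congr' ?_
  filter_upwards [eventually_gt_atTop 0] with T hT
  field_simp

theorem tendsto_latticeCount_div_pow [Finite ι] (ht : ∀ i, 0 < t i) (s : Finset ι) :
    Tendsto (fun T => latticeCount s t T / T ^ s.card) atTop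
      (nhds (1 / (s.card ! * ∏ i ∈ s, t i))) := by
  have hP : 0 < ∏ i ∈ s, t i := Finset.prod_pos fun i _ => ht i
  have hup : Tendsto (fun T : ℝ => ((T + ∑ i ∈ s, t i) / T) ^ s.card *
      (1 / (s.card ! * ∏ i ∈ s, t i))) atTop (nhds (1 / (s.card ! * ∏ i ∈ s, t i))) := by
    simpa using ((tendsto_add_div_self (∑ i ∈ s, t i)).pow s.card).mul_const
      (1 / (s.card ! * ∏ i ∈ s, t i))
  refine tendsto_of_tendsto_of_tendsto_of_le_of_le' tendsto_const_nhds hup ?_ ?_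
  · filter_upwards [eventually_gt_atTop 0] with T hT
    rw [le_div_iff₀ (by positivity)]
    refine le_trans (le_of_eq ?_) (le_latticeCount ht s T hT.le)
    rw [simplexVolume]; ring
  · filter_upwards [eventually_gt_atTop 0] with T hT
    rw [div_le_iff₀ (by positivity)]
    refine (latticeCount_le ht s T hT.le).trans (le_of_eq ?_)
    rw [simplexVolume, div_pow]
    field_simp

end LatticePoints

/-! ### Increments of the lattice point count -/

section Increments

/-- The `h` for which `L (T + h) - L T` grows like `c * h * T ^ k`. -/
def incrementSubgroup (L : ℝ → ℝ) (k : ℕ) (c : ℝ) : AddSubgroup ℝ :=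
  -- The base point may be moved by a constant because `(T + a) ^ k ~ T ^ k`; closure under sums and
  -- negatives follows.
  have shift : ∀ {h : ℝ}, Tendsto (fun T => (L (T + h) - L T) / T ^ k) atTop (nhds (c * h)) →
      ∀ a, Tendsto (fun T => (L (T + a + h) - L (T + a)) / T ^ k) atTop (nhds (c * h)) := by
    intro h hh a
    have h1 := (hh.comp (tendsto_atTop_add_const_right atTop a tendsto_id)).mul
      ((tendsto_add_div_self a).pow k)
    rw [one_pow, mul_one] at h1
    refine h1.congr' ?_
    filter_upwards [eventually_gt_atTop 0, eventually_gt_atTop (-a)] with T hT hTa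
    have : 0 < T + a := by linarith
    simp only [Function.comp, id, div_pow]
    field_simp
  { carrier := {h | Tendsto (fun T => (L (T + h) - L T) / T ^ k) atTop (nhds (c * h))}
    zero_mem' := by simp
    add_mem' := by
      intro a b ha hb
      have h1 := (shift hb a).add ha
      rw [← mul_add, add_comm b a] at h1
      refine h1.congr fun T => ?_
      rw [← add_div, add_assoc]
      congr 1
      ring
    neg_mem' := by
      intro a ha
      have h1 := (shift ha (-a)).neg
      rw [← mul_neg] at h1
      refine h1.congr fun T => ?_
      rw [neg_add_cancel_right, ← neg_div, neg_sub] }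

theorem mem_incrementSubgroup {L : ℝ → ℝ} {k : ℕ} {c h : ℝ} :
    h ∈ incrementSubgroup L k c ↔
      Tendsto (fun T => (L (T + h) - L T) / T ^ k) atTop (nhds (c * h)) :=
  Iff.rfl

/-- By monotonicity the increment over `h` is squeezed between those over nearby members of the
dense subgroup. -/
theorem incrementSubgroup_eq_top {L : ℝ → ℝ} (hL : Monotone L) {k : ℕ} {c : ℝ}
    (hd : Dense (incrementSubgroup L k c : Set ℝ)) (h : ℝ) :
    h ∈ incrementSubgroup L k c := by
  have hmul : Continuous fun x : ℝ => c * x := by fun_prop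
  rw [mem_incrementSubgroup]
  refine tendsto_order.2 ⟨fun a ha => ?_, fun a ha => ?_⟩
  · have h1 : ∀ᶠ x in nhdsWithin h (Set.Iio h), a < c * x :=
      nhdsWithin_le_nhds (hmul.continuousAt.eventually (lt_mem_nhds ha))
    obtain ⟨l, hl, hl'⟩ := (mem_nhdsLT_iff_exists_Ioo_subset).1 h1
    obtain ⟨x, hx, hxl⟩ := hd.exists_between hl
    filter_upwards [(tendsto_order.1 (mem_incrementSubgroup.1 hx)).1 a (hl' hxl),
      eventually_gt_atTop 0] with T hT hT0
    refine hT.trans_le (div_le_div_of_nonneg_right ?_ (by positivity))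
    exact sub_le_sub_right (hL (by linarith [hxl.2])) _
  · have h1 : ∀ᶠ x in nhdsWithin h (Set.Ioi h), c * x < a :=
      nhdsWithin_le_nhds (hmul.continuousAt.eventually (gt_mem_nhds ha))
    obtain ⟨l, hl, hl'⟩ := (mem_nhdsGT_iff_exists_Ioo_subset).1 h1
    obtain ⟨x, hx, hxl⟩ := hd.exists_between hl
    filter_upwards [(tendsto_order.1 (mem_incrementSubgroup.1 hx)).2 a (hl' hxl),
      eventually_gt_atTop 0] with T hT hT0
    refine lt_of_le_of_lt (div_le_div_of_nonneg_right ?_ (by positivity)) hT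
    exact sub_le_sub_right (hL (by linarith [hxl.1])) _

variable {ι : Type*} [Finite ι] {s : Finset ι} {t : ι → ℝ}

/-- By the recursion, the increment over a step `t j` is the lattice count in one dimension less,
whose leading term is known. -/
theorem mem_incrementSubgroup_latticeCount (ht : ∀ i, 0 < t i) {j : ι} (hj : j ∈ s) :
    t j ∈ incrementSubgroup (latticeCount s t) (s.card - 1)
      (1 / ((s.card - 1)! * ∏ i ∈ s, t i)) := by
  classical
  rw [← neg_mem_iff, mem_incrementSubgroup]
  have h1 := (tendsto_latticeCount_div_pow ht (s.erase j)).neg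
  rw [Finset.card_erase_of_mem hj] at h1
  have hP : 0 < ∏ i ∈ s.erase j, t i := Finset.prod_pos fun i _ => ht i
  have htj := ht j
  rw [← Finset.mul_prod_erase s t hj]
  convert h1 using 2 with T
  · rw [← neg_div]
    congr 1
    have h2 := latticeCount_insert (T := T) ht (Finset.notMem_erase j s)
    rw [Finset.insert_erase hj] at h2
    rw [h2]
    ring_nf
  · field_simp

/-- If two of the weights are incommensurable, lattice points are asymptotically equidistributed
over windows of bounded length. -/
theorem tendsto_latticeCount_increment (ht : ∀ i, 0 < t i) {i j : ι} (hi : i ∈ s) (hj : j ∈ s)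
    (hij : Irrational (t i / t j)) (h : ℝ) :
    Tendsto (fun T => (latticeCount s t (T + h) - latticeCount s t T) / T ^ (s.card - 1)) atTop
      (nhds (1 / ((s.card - 1)! * ∏ i ∈ s, t i) * h)) := by
  refine mem_incrementSubgroup.1 (incrementSubgroup_eq_top (latticeCount_mono ht) ?_ h)
  refine (dense_addSubgroupClosure_pair_iff.2 hij).mono ?_
  rw [SetLike.coe_subset_coe, AddSubgroup.closure_le]
  rintro x (rfl | rfl)
  · exact mem_incrementSubgroup_latticeCount ht hi
  · exact mem_incrementSubgroup_latticeCount ht hj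

end Increments

/-! ### Routes, the tree and elementary cycles -/

namespace MetricDigraph

variable {V E : Type*} {G : MetricDigraph V E} {s u v w : V} {F : Set E}

theorem isRoute_append {p q : List E} :
    G.IsRoute u (p ++ q) w ↔ ∃ v, G.IsRoute u p v ∧ G.IsRoute v q w := by
  induction p generalizing u with
  | nil => simp [IsRoute]
  | cons e p ih => simp [IsRoute, ih, and_assoc]

theorem isRoute_concat {p : List E} {e : E} :
    G.IsRoute u (p ++ [e]) w ↔ G.IsRoute u p (G.src e) ∧ G.tgt e = w := by
  rw [isRoute_append]
  constructor
  · rintro ⟨v, h, rfl, h'⟩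
    exact ⟨h, h'⟩
  · rintro ⟨h, h'⟩
    exact ⟨_, h, rfl, h'⟩

/-- The passage time of a route. -/
noncomputable def routeLen (G : MetricDigraph V E) (p : List E) : ℝ := (p.map G.len).sum

@[simp] theorem routeLen_nil : G.routeLen [] = 0 := by simp [routeLen]

@[simp] theorem routeLen_cons (e : E) (p : List E) :
    G.routeLen (e :: p) = G.len e + G.routeLen p := by simp [routeLen]

@[simp] theorem routeLen_append (p q : List E) :
    G.routeLen (p ++ q) = G.routeLen p + G.routeLen q := by simp [routeLen]

theorem routeLen_nonneg (p : List E) : 0 ≤ G.routeLen p := by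
  refine List.sum_nonneg fun x hx => ?_
  obtain ⟨e, -, rfl⟩ := List.mem_map.1 hx
  exact (G.len_pos e).le

namespace IsOutTree

/-- The route in the tree from the root to `v`. -/
noncomputable def path (hF : G.IsOutTree s F) (v : V) : List E := (hF v).choose

/-- The passage time of the route in the tree from the root to `v`. -/
noncomputable def depth (hF : G.IsOutTree s F) (v : V) : ℝ := G.routeLen (hF.path v)

/-- The passage time of the cycle that an edge `e` from the tree back to the root closes. -/
noncomputable def backTime (hF : G.IsOutTree s F) (e : E) : ℝ := hF.depth (G.src e) + G.len e

/-- The cycle that an edge `e` from the tree back to the root closes. -/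
noncomputable def backCycle (hF : G.IsOutTree s F) (e : E) : Cycle E :=
  (hF.path (G.src e) ++ [e] : List E)

variable (hF : G.IsOutTree s F)

theorem isRoute_path (v : V) : G.IsRoute s (hF.path v) v := (hF v).choose_spec.1.1

theorem mem_of_mem_path {e : E} (he : e ∈ hF.path v) : e ∈ F := (hF v).choose_spec.1.2 e he

theorem eq_path {p : List E} (hp : G.IsRoute s p v) (hpF : ∀ e ∈ p, e ∈ F) : p = hF.path v :=
  (hF v).choose_spec.2 p ⟨hp, hpF⟩

theorem path_root : hF.path s = [] := (hF.eq_path (p := []) rfl (by simp)).symm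

theorem depth_root : hF.depth s = 0 := by simp [depth, hF.path_root]

theorem depth_nonneg (v : V) : 0 ≤ hF.depth v := routeLen_nonneg _

theorem backTime_pos (e : E) : 0 < hF.backTime e :=
  add_pos_of_nonneg_of_pos (hF.depth_nonneg _) (G.len_pos e)

theorem path_tgt {e : E} (he : e ∈ F) : hF.path (G.tgt e) = hF.path (G.src e) ++ [e] := by
  refine (hF.eq_path (isRoute_concat.2 ⟨hF.isRoute_path _, rfl⟩) fun f hf => ?_).symm
  rcases List.mem_append.1 hf with h | h
  · exact hF.mem_of_mem_path h
  · rwa [List.mem_singleton.1 h]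

theorem depth_tgt {e : E} (he : e ∈ F) : hF.depth (G.tgt e) = hF.backTime e := by
  simp [depth, backTime, hF.path_tgt he]

theorem injOn_tgt (hF : G.IsOutTree s F) : Set.InjOn G.tgt F := by
  intro e he f hf h
  have := hF.path_tgt he
  rw [h, hF.path_tgt hf] at this
  simpa using (List.append_inj_right' this rfl).symm

theorem tgt_ne_root (hF : G.IsOutTree s F) {e : E} (he : e ∈ F) : G.tgt e ≠ s := by
  intro h
  have := hF.path_tgt he
  rw [h, hF.path_root] at this
  simp at this

theorem exists_tgt_eq (hF : G.IsOutTree s F) (hv : v ≠ s) : ∃ e ∈ F, G.tgt e = v := by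
  rcases List.eq_nil_or_concat' (hF.path v) with h | ⟨p, e, h⟩
  · have := hF.isRoute_path v
    rw [h] at this
    exact absurd this.symm hv
  · have hr := hF.isRoute_path v
    rw [h] at hr
    exact ⟨e, hF.mem_of_mem_path (v := v) (by simp [h]), (isRoute_concat.1 hr).2⟩

theorem image_tgt (hF : G.IsOutTree s F) : G.tgt '' F = {s}ᶜ := by
  ext v
  constructor
  · rintro ⟨e, he, rfl⟩
    exact hF.tgt_ne_root he
  · exact fun hv => hF.exists_tgt_eq hv

theorem nodup_of_subset (hF : G.IsOutTree s F) {p : List E} (hp : G.IsRoute s p v)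
    (hpF : ∀ e ∈ p, e ∈ F) : (p.map G.src).Nodup ∧ v ∉ p.map G.src := by
  -- A closed piece `z` inside `p` would give two tree routes to the same vertex, `x` and `x ++ z`.
  have key : ∀ (x y : List E) (e : E), p = x ++ e :: y → ∀ z w, e :: y = z ++ w → z ≠ [] →
      G.IsRoute (G.src e) z (G.src e) → False := by
    intro x y e hxy z w hzw hz hr
    have hx : G.IsRoute s x (G.src e) := by
      rw [hxy, isRoute_append] at hp
      obtain ⟨u, hu, hu', -⟩ := hp
      rwa [hu']
    have h1 := hF.eq_path hx fun f hf => hpF f (by simp [hxy, hf])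
    have h2 := hF.eq_path (isRoute_append.2 ⟨_, hx, hr⟩) fun f hf => hpF f (by
      rw [hxy, hzw, ← List.append_assoc]
      exact List.mem_append_left _ hf)
    rw [← h1] at h2
    simp at h2
    exact hz h2
  have hv : v ∉ p.map G.src := by
    intro h
    obtain ⟨e, he, rfl⟩ := List.mem_map.1 h
    obtain ⟨x, y, hxy⟩ := List.append_of_mem he
    refine key x y e hxy (e :: y) [] (by simp) (by simp) ?_
    rw [hxy, isRoute_append] at hp
    obtain ⟨u, -, hu, hu'⟩ := hp
    exact ⟨rfl, hu'⟩
  refine ⟨?_, hv⟩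
  have suff : ∀ (b a : List E), p = a ++ b → (b.map G.src).Nodup := by
    intro b
    induction b with
    | nil => simp
    | cons e b ih =>
      intro a hab
      rw [List.map_cons, List.nodup_cons]
      refine ⟨fun h => ?_, ih (a ++ [e]) (by simp [hab])⟩
      obtain ⟨f, hf, hfe⟩ := List.mem_map.1 h
      obtain ⟨x, y, hxy⟩ := List.append_of_mem hf
      refine key a b e hab (e :: x) (f :: y) (by simp [hxy]) (by simp) ?_
      rw [hab, isRoute_append] at hp
      obtain ⟨u, -, hu, hu'⟩ := hp
      rw [hxy, isRoute_append] at hu'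
      obtain ⟨w, hw, hw', -⟩ := hu'
      exact ⟨rfl, by rwa [← hfe, hw']⟩
  exact suff p [] rfl

theorem backCycle_mem (hb : ∀ e, e ∉ F → G.tgt e = s) {e : E} (he : e ∉ F) :
    hF.backCycle e ∈ G.elementaryCycles := by
  refine ⟨s, hF.path (G.src e) ++ [e], by simp, ?_, ?_, rfl⟩
  · exact isRoute_concat.2 ⟨hF.isRoute_path _, hb e he⟩
  · have h := hF.nodup_of_subset (hF.isRoute_path (G.src e)) fun f hf => hF.mem_of_mem_path hf
    rw [List.map_append, List.nodup_append]
    refine ⟨h.1, by simp, ?_⟩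
    rintro a ha b hb' rfl
    obtain rfl : a = G.src e := by simpa using hb'
    exact h.2 ha

/-- A cycle inside the tree would contradict uniqueness of tree routes. Rotated so that a back edge
comes last, the cycle starts at `s`; a second back edge would make it visit `s` twice, so the rest
is the tree path. -/
theorem exists_backCycle_eq (hb : ∀ e, e ∉ F → G.tgt e = s) {c : Cycle E}
    (hc : c ∈ G.elementaryCycles) : ∃ e, e ∉ F ∧ hF.backCycle e = c := by
  obtain ⟨v, p, hp0, hp, hnd, rfl⟩ := hc
  obtain ⟨e, he, heF⟩ : ∃ e ∈ p, e ∉ F := by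
    by_contra! h
    have h2 := hF.eq_path (isRoute_append.2 ⟨_, hF.isRoute_path v, hp⟩) fun f hf =>
      (List.mem_append.1 hf).elim (fun h => hF.mem_of_mem_path h) (h f)
    simp at h2
    exact hp0 h2
  obtain ⟨a, b, rfl⟩ := List.append_of_mem he
  have hrot : (a ++ e :: b) ~r (b ++ a ++ [e]) := by
    have : a ++ e :: b = (a ++ [e]) ++ b := by simp
    rw [this, List.append_assoc b]
    exact List.isRotated_append
  have hnd' : ((b ++ a ++ [e]).map G.src).Nodup := (hrot.map G.src).nodup_iff.1 hnd
  have hr : G.IsRoute s (b ++ a) (G.src e) := by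
    rw [isRoute_append] at hp
    obtain ⟨w, hw, rfl, hw'⟩ := hp
    rw [hb e heF] at hw'
    exact isRoute_append.2 ⟨v, hw', hw⟩
  have hsub : ∀ f ∈ b ++ a, f ∈ F := by
    intro f hf
    by_contra hfF
    obtain ⟨x, y, hxy⟩ := List.append_of_mem hf
    rw [hxy] at hr hnd'
    have head : ∀ (z : List E) (g : E) (u u' : V), G.IsRoute u z u' → G.src g = u' →
        u ∈ (z ++ [g]).map G.src := by
      rintro (_ | ⟨k, z⟩) g u u' h h'
      · simp [h', show u = u' from h]
      · simp [h.1]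
    rw [isRoute_append] at hr
    obtain ⟨w, hw, rfl, hw'⟩ := hr
    rw [hb f hfF] at hw'
    have h1 := head x f s _ hw rfl
    have h2 := head y e s _ hw' rfl
    rw [show x ++ f :: y ++ [e] = (x ++ [f]) ++ (y ++ [e]) by simp, List.map_append,
      List.nodup_append] at hnd'
    exact hnd'.2.2 _ h1 _ h2 rfl
  refine ⟨e, heF, ?_⟩
  rw [backCycle, ← hF.eq_path hr hsub]
  exact Cycle.coe_eq_coe.2 hrot.symm

theorem injOn_backCycle : Set.InjOn hF.backCycle Fᶜ := by
  intro e he f hf h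
  have h1 : e ∈ hF.backCycle e := by simp [backCycle]
  rw [h, backCycle, Cycle.mem_coe_iff] at h1
  rcases List.mem_append.1 h1 with h1 | h1
  · exact absurd (hF.mem_of_mem_path h1) he
  · exact List.mem_singleton.1 h1

theorem cycleLen_backCycle (e : E) : G.cycleLen (hF.backCycle e) = hF.backTime e := by
  simp [cycleLen, backCycle, backTime, depth, routeLen]

end IsOutTree

/-! ### Back edges and passage times -/

/-- The edges outside the tree `F`. -/
noncomputable def backEdges [Finite E] (F : Set E) : Finset E := (Set.toFinite Fᶜ).toFinset

@[simp] theorem mem_backEdges [Finite E] {e : E} : e ∈ backEdges F ↔ e ∉ F := by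
  simp [backEdges]

namespace IsOutTree

variable (hF : G.IsOutTree s F)

theorem cycleFinset_eq [Finite E] [DecidableEq (Cycle E)] (hb : ∀ e, e ∉ F → G.tgt e = s) :
    G.cycleFinset = (backEdges F).image hF.backCycle := by
  ext c
  simp only [cycleFinset, Set.Finite.mem_toFinset, Finset.mem_image, mem_backEdges]
  constructor
  · exact hF.exists_backCycle_eq hb
  · rintro ⟨e, he, rfl⟩
    exact hF.backCycle_mem hb he

theorem card_cycleFinset (hF : G.IsOutTree s F) [Finite E] (hb : ∀ e, e ∉ F → G.tgt e = s) :
    G.cycleFinset.card = (backEdges F).card := by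
  classical
  rw [hF.cycleFinset_eq hb, Finset.card_image_of_injOn]
  intro e he f hf
  exact hF.injOn_backCycle (by simpa using he) (by simpa using hf)

theorem prod_cycleLen [Finite E] (hb : ∀ e, e ∉ F → G.tgt e = s) :
    ∏ c ∈ G.cycleFinset, G.cycleLen c = ∏ e ∈ backEdges F, hF.backTime e := by
  classical
  rw [hF.cycleFinset_eq hb, Finset.prod_image]
  · simp only [hF.cycleLen_backCycle]
  · intro e he f hf
    exact hF.injOn_backCycle (by simpa using he) (by simpa using hf)

/-- The passage times of the routes from the root to `v`. -/
theorem exists_route_iff [Finite E] (hb : ∀ e, e ∉ F → G.tgt e = s) {x : ℝ} :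
    (∃ p, G.IsRoute s p v ∧ G.routeLen p = x) ↔
      ∃ n : E → ℕ, (∀ e ∉ backEdges F, n e = 0) ∧
        ∑ e ∈ backEdges F, (n e : ℝ) * hF.backTime e + hF.depth v = x := by
  classical
  constructor
  · rintro ⟨p, hp, rfl⟩
    induction p using List.reverseRecOn generalizing v with
    | nil =>
      obtain rfl : s = v := hp
      exact ⟨0, by simp, by simp [hF.depth_root]⟩
    | append_singleton p e ih =>
      obtain ⟨hp', rfl⟩ := isRoute_concat.1 hp
      obtain ⟨n, hn, h⟩ := ih hp'
      -- A tree edge only increases the depth; a back edge completes one more turn and resets the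
      -- depth to 0.
      by_cases he : e ∈ F
      · refine ⟨n, hn, ?_⟩
        rw [hF.depth_tgt he, routeLen_append, ← h, backTime]
        simp [add_assoc]
      · refine ⟨n + Pi.single e 1, fun f hf => ?_, ?_⟩
        · have : f ≠ e := fun h => hf (by simpa [h] using he)
          simp [this, hn f hf]
        · have hs : ∑ f ∈ backEdges F, (((Pi.single e 1 : E → ℕ) f : ℕ) : ℝ) * hF.backTime f =
              hF.backTime e := by
            rw [Finset.sum_eq_single e]
            · simp
            · intro f _ hf
              simp [hf]
            · simp [he]
          simp only [Pi.add_apply, Nat.cast_add, add_mul, Finset.sum_add_distrib]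
          rw [hs, hb e he, hF.depth_root, routeLen_append, ← h, backTime]
          simp [add_assoc]
  · rintro ⟨n, -, rfl⟩
    -- Closed routes at `s` concatenate, so their lengths are closed under addition.
    let M : AddSubmonoid ℝ :=
      { carrier := {x | ∃ p, G.IsRoute s p s ∧ G.routeLen p = x}
        zero_mem' := ⟨[], rfl, by simp⟩
        add_mem' := by
          rintro _ _ ⟨p, hp, rfl⟩ ⟨q, hq, rfl⟩
          exact ⟨p ++ q, isRoute_append.2 ⟨s, hp, hq⟩, by simp⟩ }
    have hM : ∑ e ∈ backEdges F, (n e : ℝ) * hF.backTime e ∈ M := by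
      refine sum_mem fun e he => ?_
      rw [← nsmul_eq_mul]
      refine nsmul_mem ?_ _
      refine ⟨hF.path (G.src e) ++ [e], isRoute_concat.2 ⟨hF.isRoute_path _, ?_⟩, ?_⟩
      · exact hb e (by simpa using he)
      · simp [backTime, depth]
    obtain ⟨p, hp, h⟩ := hM
    exact ⟨p ++ hF.path v, isRoute_append.2 ⟨s, hp, hF.isRoute_path v⟩, by simp [h, depth]⟩

/-- A `ℚ`-linear functional that singles out the cycle through a given edge outside the tree. -/
theorem exists_linearMap_backTime [DecidableEq E] (hlen : LinearIndependent ℚ G.len) {f : E}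
    (hf : f ∉ F) : ∃ g : ℝ →ₗ[ℚ] ℚ, ∀ e, g (hF.backTime e) = if e = f then 1 else 0 := by
  -- The coordinate of `len f` on the rational span of the lengths, extended to `ℝ`. It kills tree
  -- paths, as they avoid `f`.
  obtain ⟨g, hg⟩ := LinearMap.exists_extend
    ((Module.Basis.span hlen).constr ℚ fun e => if e = f then (1 : ℚ) else 0)
  have hg' : ∀ e, g (G.len e) = if e = f then 1 else 0 := by
    intro e
    have h := LinearMap.congr_fun hg (Module.Basis.span hlen e)
    rw [Module.Basis.constr_basis] at h
    rw [← h]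
    simp [Module.Basis.span_apply]
  have hp : ∀ p : List E, (∀ e ∈ p, e ∈ F) → g (G.routeLen p) = 0 := by
    intro p
    induction p with
    | nil => simp
    | cons e p ih =>
      intro h
      have he : e ≠ f := fun h' => hf (h' ▸ h e (by simp))
      rw [routeLen_cons, map_add, ih fun e he => h e (by simp [he]), hg']
      simp [he]
  refine ⟨g, fun e => ?_⟩
  rw [backTime, depth, map_add, hp _ fun e he => hF.mem_of_mem_path he, hg', zero_add]

theorem sum_backTime_injective [Finite E] (hlen : LinearIndependent ℚ G.len) {m n : E → ℕ}
    (hm : ∀ e ∉ backEdges F, m e = 0) (hn : ∀ e ∉ backEdges F, n e = 0)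
    (h : ∑ e ∈ backEdges F, (m e : ℝ) * hF.backTime e =
      ∑ e ∈ backEdges F, (n e : ℝ) * hF.backTime e) : m = n := by
  classical
  funext f
  by_cases hf : f ∈ backEdges F
  · obtain ⟨g, hg⟩ := hF.exists_linearMap_backTime hlen (mem_backEdges.1 hf)
    have key : ∀ k : E → ℕ, g (∑ e ∈ backEdges F, (k e : ℝ) * hF.backTime e) = k f := by
      intro k
      simp only [← nsmul_eq_mul, map_sum, map_nsmul, hg]
      simp only [nsmul_eq_mul, mul_ite, mul_one, mul_zero, Finset.sum_ite_eq', hf, if_true]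
    have := congrArg g h
    rw [key, key] at this
    exact_mod_cast this
  · rw [hm f hf, hn f hf]

theorem irrational_backTime_div (hlen : LinearIndependent ℚ G.len) {e f : E} (he : e ∉ F)
    (hef : e ≠ f) : Irrational (hF.backTime e / hF.backTime f) := by
  classical
  rintro ⟨r, hr⟩
  obtain ⟨g, hg⟩ := hF.exists_linearMap_backTime hlen he
  have h : hF.backTime e = r • hF.backTime f := by
    rw [Rat.smul_def, hr, div_mul_cancel₀ _ (hF.backTime_pos f).ne']
  have := congrArg g h
  rw [map_smul, hg, hg] at this
  simp [hef.symm] at this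

end IsOutTree

end MetricDigraph

/-! ### From the random walk to routes -/

namespace MetricDigraph

variable {V E : Type*} {G : MetricDigraph V E} {s : V}

theorem entryTime_eq_routeLen (a : ℕ → E) (n : ℕ) :
    G.entryTime a n = G.routeLen ((List.range n).map a) := by
  induction n with
  | zero => simp [entryTime]
  | succ n ih =>
    rw [List.range_succ, List.map_append, routeLen_append, ← ih, entryTime, entryTime,
      Finset.sum_range_succ]
    simp

theorem map_range_getD (p : List E) (e : E) :
    (List.range p.length).map (fun i => p.getD i e) = p := by
  refine List.ext_getElem (by simp) fun i h1 h2 => ?_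
  simp [h2]

namespace IsRandomWalk

variable {q : V → PMF E} {Ω : Type*} [MeasurableSpace Ω] {μ : Measure Ω} {X : ℕ → Ω → E}

theorem exists_src_eq (hX : G.IsRandomWalk s q μ X) (v : V) : ∃ e, G.src e = v := by
  obtain ⟨e, he⟩ := (q v).support_nonempty
  exact ⟨e, (hX.ne_zero_iff v e).1 ((PMF.mem_support_iff _ _).1 he)⟩

theorem measure_cylinder_ne_zero_iff (hX : G.IsRandomWalk s q μ X) (n : ℕ) (a : ℕ → E) :
    μ {ω | ∀ i ≤ n, X i ω = a i} ≠ 0 ↔ G.IsRoute s ((List.range n).map a) (G.src (a n)) := by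
  induction n with
  | zero =>
    have h := hX.init (a 0)
    simp only [nonpos_iff_eq_zero, forall_eq]
    rw [h, hX.ne_zero_iff]
    exact eq_comm
  | succ n ih =>
    rw [hX.step, mul_ne_zero_iff, ih, hX.ne_zero_iff, List.range_succ, List.map_append,
      List.map_singleton, isRoute_concat, eq_comm (a := G.tgt (a n))]

/-- An event that depends only on the first `n + 1` edges has non-zero probability exactly if some
route is in it. -/
theorem measure_ne_zero_iff (hX : G.IsRandomWalk s q μ X) [Finite E] (n : ℕ) (A : Set (ℕ → E))
    (hA : ∀ a b : ℕ → E, (∀ i ≤ n, a i = b i) → a ∈ A → b ∈ A) :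
    μ {ω | (fun i => X i ω) ∈ A} ≠ 0 ↔
      ∃ a ∈ A, G.IsRoute s ((List.range n).map a) (G.src (a n)) := by
  constructor
  · contrapose!
    intro h
    -- Repeating the last edge forever chooses one representative for each of the finitely many
    -- initial words.
    let ext : (Fin (n + 1) → E) → ℕ → E := fun r i => r ⟨min i n, by omega⟩
    have hsub : {ω | (fun i => X i ω) ∈ A} ⊆
        ⋃ r : {r : Fin (n + 1) → E // ext r ∈ A}, {ω | ∀ i ≤ n, X i ω = ext r.1 i} := by
      intro ω hω
      have hagree : ∀ i ≤ n, X i ω = ext (fun j => X j ω) i := by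
        intro i hi
        simp [ext, hi]
      exact Set.mem_iUnion.2 ⟨⟨fun j => X j ω, hA _ _ hagree hω⟩, hagree⟩
    refine measure_mono_null hsub (measure_iUnion_null fun r => ?_)
    by_contra h0
    exact h _ r.2 ((hX.measure_cylinder_ne_zero_iff n _).1 h0)
  · rintro ⟨a, ha, hr⟩ h0
    refine (hX.measure_cylinder_ne_zero_iff n a).2 hr (measure_mono_null ?_ h0)
    intro ω hω
    exact hA a _ (fun i hi => (hω i hi).symm) ha

theorem inner_mem_endpoints_iff (hX : G.IsRandomWalk s q μ X) [Finite E] {T : ℝ} {e : E}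
    {x : Set.Ioo (0 : ℝ) (G.len e)} : Point.inner e x ∈ G.endpoints μ X T ↔
      ∃ p, G.IsRoute s p (G.src e) ∧ G.routeLen p + x = T := by
  have hU : {ω | G.IsAt (fun n => X n ω) T (.inner e x)} =
      ⋃ n, {ω | (fun i => X i ω) ∈ {a : ℕ → E | a n = e ∧ G.entryTime a n + x = T}} := by
    ext ω
    simp [IsAt]
  have hA : ∀ n (a b : ℕ → E), (∀ i ≤ n, a i = b i) →
      a ∈ {a : ℕ → E | a n = e ∧ G.entryTime a n + x = T} →
      b ∈ {a : ℕ → E | a n = e ∧ G.entryTime a n + x = T} := by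
    rintro n a b hab ⟨h1, h2⟩
    refine ⟨by rw [← hab n le_rfl, h1], ?_⟩
    rw [← h2, entryTime, entryTime, Finset.sum_congr rfl fun i hi => ?_]
    rw [hab i (Finset.mem_range.1 hi).le]
  rw [endpoints, Set.mem_ofPred_eq, hU, pos_iff_ne_zero, Ne, measure_iUnion_null_iff, not_forall]
  constructor
  · rintro ⟨n, hn⟩
    obtain ⟨a, ⟨h1, h2⟩, hr⟩ := (hX.measure_ne_zero_iff n _ (hA n)).1 hn
    exact ⟨_, h1 ▸ hr, by rw [← h2, entryTime_eq_routeLen]⟩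
  · rintro ⟨p, hp, h⟩
    have ha : p.getD p.length e = e := by simp
    -- The sequence is `p` followed by `e` forever; only its first `p.length + 1` terms matter.
    refine ⟨p.length, (hX.measure_ne_zero_iff _ _ (hA _)).2 ⟨fun i => p.getD i e, ⟨ha, ?_⟩, ?_⟩⟩
    · rw [entryTime_eq_routeLen, map_range_getD, h]
    · dsimp only
      rwa [map_range_getD, ha]

theorem vertex_mem_endpoints_iff (hX : G.IsRandomWalk s q μ X) [Finite E] {T : ℝ} {v : V} :
    Point.vertex v ∈ G.endpoints μ X T ↔ ∃ p, G.IsRoute s p v ∧ G.routeLen p = T := by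
  have hU : {ω | G.IsAt (fun n => X n ω) T (.vertex v)} =
      ⋃ n, {ω | (fun i => X i ω) ∈ {a : ℕ → E | G.entryTime a n = T ∧ G.src (a n) = v}} := by
    ext ω
    simp [IsAt]
  have hA : ∀ n (a b : ℕ → E), (∀ i ≤ n, a i = b i) →
      a ∈ {a : ℕ → E | G.entryTime a n = T ∧ G.src (a n) = v} →
      b ∈ {a : ℕ → E | G.entryTime a n = T ∧ G.src (a n) = v} := by
    rintro n a b hab ⟨h1, h2⟩
    refine ⟨?_, by rw [← hab n le_rfl, h2]⟩
    rw [← h1, entryTime, entryTime, Finset.sum_congr rfl fun i hi => ?_]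
    rw [hab i (Finset.mem_range.1 hi).le]
  rw [endpoints, Set.mem_ofPred_eq, hU, pos_iff_ne_zero, Ne, measure_iUnion_null_iff, not_forall]
  constructor
  · rintro ⟨n, hn⟩
    obtain ⟨a, ⟨h1, h2⟩, hr⟩ := (hX.measure_ne_zero_iff n _ (hA n)).1 hn
    exact ⟨_, h2 ▸ hr, by rw [← h1, entryTime_eq_routeLen]⟩
  · rintro ⟨p, hp, h⟩
    obtain ⟨e, rfl⟩ := hX.exists_src_eq v
    have ha : p.getD p.length e = e := by simp
    refine ⟨p.length, (hX.measure_ne_zero_iff _ _ (hA _)).2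
      ⟨fun i => p.getD i e, ⟨?_, congrArg G.src ha⟩, ?_⟩⟩
    · rw [entryTime_eq_routeLen, map_range_getD, h]
    · dsimp only
      rwa [map_range_getD, ha]

end IsRandomWalk

end MetricDigraph

/-! ### Counting points edge by edge -/

namespace MetricDigraph

variable {V E : Type*} {G : MetricDigraph V E} {s : V} {F : Set E}

open Classical in
/-- The point at distance `x` from the beginning of the edge `e`, where `0 ≤ x < G.len e`. -/
noncomputable def pointAt (G : MetricDigraph V E) (e : E) (x : ℝ) : G.Point :=
  if h : x ∈ Set.Ioo 0 (G.len e) then .inner e ⟨x, h⟩ else .vertex (G.src e)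

theorem pointAt_zero (e : E) : G.pointAt e 0 = .vertex (G.src e) := by simp [pointAt]

theorem pointAt_of_pos {e : E} {x : ℝ} (h : x ∈ Set.Ioo 0 (G.len e)) :
    G.pointAt e x = .inner e ⟨x, h⟩ := dif_pos h

theorem injOn_pointAt (e : E) : Set.InjOn (G.pointAt e) (Set.Ico 0 (G.len e)) := by
  intro x hx y hy h
  rcases hx.1.eq_or_lt with rfl | hx0 <;> rcases hy.1.eq_or_lt with rfl | hy0
  · rfl
  · rw [pointAt_zero, pointAt_of_pos ⟨hy0, hy.2⟩] at h
    cases h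
  · rw [pointAt_zero, pointAt_of_pos ⟨hx0, hx.2⟩] at h
    cases h
  · rw [pointAt_of_pos ⟨hx0, hx.2⟩, pointAt_of_pos ⟨hy0, hy.2⟩] at h
    injection h with _ h
    exact congrArg Subtype.val h

namespace IsRandomWalk

variable {q : V → PMF E} {Ω : Type*} [MeasurableSpace Ω] {μ : Measure Ω} {X : ℕ → Ω → E}

theorem pointAt_mem_endpoints_iff [Finite E] (hX : G.IsRandomWalk s q μ X) {T x : ℝ} {e : E}
    (hx : x ∈ Set.Ico 0 (G.len e)) :
    G.pointAt e x ∈ G.endpoints μ X T ↔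
      ∃ p, G.IsRoute s p (G.src e) ∧ G.routeLen p + x = T := by
  rcases hx.1.eq_or_lt with rfl | hx0
  · rw [pointAt_zero, hX.vertex_mem_endpoints_iff]
    simp
  · rw [pointAt_of_pos ⟨hx0, hx.2⟩, hX.inner_mem_endpoints_iff]

end IsRandomWalk

/-- The points of the edge `e`, its end excluded, that belong to `S`. -/
def edgePart (G : MetricDigraph V E) (S : Set G.Point) (e : E) : Set G.Point :=
  G.pointAt e '' {x | x ∈ Set.Ico 0 (G.len e) ∧ G.pointAt e x ∈ S}

theorem iUnion_edgePart (hsrc : Function.Surjective G.src) (S : Set G.Point) :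
    ⋃ e, G.edgePart S e = S := by
  ext P
  rw [Set.mem_iUnion]
  constructor
  · rintro ⟨e, x, hx, rfl⟩
    exact hx.2
  · intro hP
    cases P with
    | vertex v =>
      obtain ⟨e, rfl⟩ := hsrc v
      exact ⟨e, 0, ⟨⟨le_rfl, G.len_pos e⟩, by rwa [pointAt_zero]⟩, pointAt_zero e⟩
    | inner e x =>
      exact ⟨e, x, ⟨⟨x.2.1.le, x.2.2⟩, by rwa [pointAt_of_pos x.2]⟩, pointAt_of_pos x.2⟩

theorem eq_vertex_or_inner_of_mem_edgePart {S : Set G.Point} {e : E} {P : G.Point}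
    (hP : P ∈ G.edgePart S e) : P = .vertex (G.src e) ∨ ∃ x, P = .inner e x := by
  obtain ⟨x, ⟨hx, -⟩, rfl⟩ := hP
  rcases hx.1.eq_or_lt with rfl | hx0
  · exact Or.inl (pointAt_zero e)
  · exact Or.inr ⟨_, pointAt_of_pos ⟨hx0, hx.2⟩⟩

theorem ncard_eq_sum_edgePart [Fintype E] (hsrc : Function.Bijective G.src) {S : Set G.Point}
    (hS : S.Finite) : S.ncard = ∑ e, (G.edgePart S e).ncard := by
  conv_lhs => rw [← iUnion_edgePart hsrc.2 S]
  rw [Set.ncard_iUnion_of_finite, finsum_eq_sum_of_fintype]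
  · exact fun e => hS.subset ((Set.subset_iUnion _ e).trans (iUnion_edgePart hsrc.2 S).subset)
  · intro e f hef
    refine Set.disjoint_left.2 fun P he hf => hef ?_
    rcases eq_vertex_or_inner_of_mem_edgePart he with rfl | ⟨x, rfl⟩ <;>
      rcases eq_vertex_or_inner_of_mem_edgePart hf with h | ⟨y, h⟩
    · exact hsrc.1 (by simpa using h)
    · cases h
    · cases h
    · cases h
      rfl

theorem ncard_le_sum_edgePart [Fintype E] (hsrc : Function.Surjective G.src) (S : Set G.Point) :
    S.ncard ≤ ∑ e, (G.edgePart S e).ncard := by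
  conv_lhs => rw [← iUnion_edgePart hsrc S]
  exact Set.ncard_iUnion_le_of_fintype _

/-- Without their starting vertices the parts are disjoint, and this removes at most one point per
edge. -/
theorem sum_edgePart_le_ncard_add [Fintype E] (hsrc : Function.Surjective G.src) {S : Set G.Point}
    (hS : S.Finite) : ∑ e, (G.edgePart S e).ncard ≤ S.ncard + Fintype.card E := by
  have hsub : ∀ e, G.edgePart S e ⊆ S := fun e =>
    (Set.subset_iUnion _ e).trans (iUnion_edgePart hsrc S).subset
  have h1 : ∑ e, (G.edgePart S e \ {.vertex (G.src e)}).ncard ≤ S.ncard := by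
    rw [← finsum_eq_sum_of_fintype, ← Set.ncard_iUnion_of_finite]
    · exact Set.ncard_le_ncard (Set.iUnion_subset fun e => Set.sdiff_subset.trans (hsub e)) hS
    · exact fun e => (hS.subset (hsub e)).subset Set.sdiff_subset
    · intro e f hef
      refine Set.disjoint_left.2 fun P he hf => hef ?_
      rcases eq_vertex_or_inner_of_mem_edgePart he.1 with h | ⟨x, rfl⟩
      · exact absurd h he.2
      · rcases eq_vertex_or_inner_of_mem_edgePart hf.1 with h | ⟨y, h⟩
        · cases h
        · cases h
          rfl
  have h2 : ∀ e, (G.edgePart S e).ncard ≤ (G.edgePart S e \ {.vertex (G.src e)}).ncard + 1 :=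
    fun e => Set.ncard_le_ncard_sdiff_add_ncard _ {.vertex (G.src e)} |>.trans (by simp)
  calc ∑ e, (G.edgePart S e).ncard
      ≤ ∑ e, ((G.edgePart S e \ {.vertex (G.src e)}).ncard + 1) :=
        Finset.sum_le_sum fun e _ => h2 e
    _ ≤ S.ncard + Fintype.card E := by
        rw [Finset.sum_add_distrib]
        simpa using h1

/-! ### Counting endpoints -/

namespace IsOutTree

variable (hF : G.IsOutTree s F)

section Count

variable [Finite E] {q : V → PMF E} {Ω : Type*} [MeasurableSpace Ω] {μ : Measure Ω}
  {X : ℕ → Ω → E}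

/-- The position on `e` is `T` minus the time of entry into `e`; requiring it to lie in `[0, len e)`
gives the two thresholds. -/
theorem edgePart_endpoints (hb : ∀ e, e ∉ F → G.tgt e = s) (hX : G.IsRandomWalk s q μ X)
    (T : ℝ) (e : E) :
    G.edgePart (G.endpoints μ X T) e =
      (fun n : E → ℕ => G.pointAt e
        (T - hF.depth (G.src e) - ∑ f ∈ backEdges F, (n f : ℝ) * hF.backTime f)) ''
      (latticeSimplex (backEdges F) hF.backTime (T - hF.depth (G.src e)) \
        latticeSimplex (backEdges F) hF.backTime (T - hF.backTime e)) := by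
  ext P
  constructor
  · rintro ⟨x, ⟨hx, hP⟩, rfl⟩
    rw [hX.pointAt_mem_endpoints_iff hx] at hP
    obtain ⟨p, hp, h⟩ := hP
    obtain ⟨n, hn, h'⟩ := (hF.exists_route_iff hb).1 ⟨p, hp, rfl⟩
    refine ⟨n, ⟨⟨hn, ?_⟩, fun h2 => ?_⟩, ?_⟩
    · linarith [hx.1]
    · have := h2.2
      rw [backTime] at this
      linarith [hx.2]
    · dsimp only
      congr 1
      linarith
  · rintro ⟨n, ⟨⟨hn, h1⟩, h2⟩, rfl⟩
    have h3 : T - hF.backTime e < ∑ f ∈ backEdges F, (n f : ℝ) * hF.backTime f :=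
      lt_of_not_ge fun h => h2 ⟨hn, h⟩
    rw [backTime] at h3
    have hx : T - hF.depth (G.src e) - ∑ f ∈ backEdges F, (n f : ℝ) * hF.backTime f ∈
        Set.Ico 0 (G.len e) := ⟨by linarith, by linarith⟩
    refine ⟨_, ⟨hx, ?_⟩, rfl⟩
    rw [hX.pointAt_mem_endpoints_iff hx]
    obtain ⟨p, hp, h⟩ := (hF.exists_route_iff hb).2 ⟨n, hn, rfl⟩
    exact ⟨p, hp, by rw [h]; ring⟩

theorem ncard_edgePart_endpoints (hb : ∀ e, e ∉ F → G.tgt e = s)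
    (hlen : LinearIndependent ℚ G.len) (hX : G.IsRandomWalk s q μ X) (T : ℝ) (e : E) :
    ((G.edgePart (G.endpoints μ X T) e).ncard : ℝ) =
      latticeCount (backEdges F) hF.backTime (T - hF.depth (G.src e)) -
        latticeCount (backEdges F) hF.backTime (T - hF.backTime e) := by
  have hle : T - hF.backTime e ≤ T - hF.depth (G.src e) := by
    rw [backTime]
    linarith [G.len_pos e]
  rw [hF.edgePart_endpoints hb hX, Set.InjOn.ncard_image, latticeCount, latticeCount,
    Set.cast_ncard_sdiff (latticeSimplex_mono hle) (latticeSimplex_finite hF.backTime_pos)]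
  have hmem : ∀ n ∈ latticeSimplex (backEdges F) hF.backTime (T - hF.depth (G.src e)) \
      latticeSimplex (backEdges F) hF.backTime (T - hF.backTime e),
      T - hF.depth (G.src e) - ∑ f ∈ backEdges F, (n f : ℝ) * hF.backTime f ∈
        Set.Ico 0 (G.len e) := by
    rintro n ⟨⟨hn, h1⟩, h2⟩
    have h3 : T - hF.backTime e < ∑ f ∈ backEdges F, (n f : ℝ) * hF.backTime f :=
      lt_of_not_ge fun h => h2 ⟨hn, h⟩
    rw [backTime] at h3
    exact ⟨by linarith, by linarith⟩
  intro m hm n hn h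
  have := injOn_pointAt e (hmem m hm) (hmem n hn) h
  exact hF.sum_backTime_injective hlen hm.1.1 hn.1.1 (by linarith)

theorem finite_endpoints (hF : G.IsOutTree s F) (hb : ∀ e, e ∉ F → G.tgt e = s)
    (hX : G.IsRandomWalk s q μ X) (T : ℝ) :
    (G.endpoints μ X T).Finite := by
  rw [← iUnion_edgePart hX.exists_src_eq (G.endpoints μ X T)]
  refine Set.finite_iUnion fun e => ?_
  rw [hF.edgePart_endpoints hb hX]
  exact ((latticeSimplex_finite hF.backTime_pos).subset Set.sdiff_subset).image _

end Count

theorem backEdges_nonempty (hF : G.IsOutTree s F) [Finite E] [Nonempty E]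
    (hG : G.IsStronglyConnected) : (backEdges F).Nonempty := by
  by_contra h
  have hall : ∀ e, e ∈ F := by
    intro e
    by_contra he
    exact h ⟨e, mem_backEdges.2 he⟩
  obtain ⟨e⟩ := ‹Nonempty E›
  obtain ⟨p, hp⟩ := hG (G.tgt e) s
  have h1 := hF.eq_path (isRoute_append.2 ⟨_, hF.isRoute_path (G.tgt e), hp⟩) fun f _ => hall f
  rw [hF.path_root, hF.path_tgt (hall e)] at h1
  simp at h1

theorem sum_tgt (hF : G.IsOutTree s F) [Fintype V] [DecidableEq V] [Fintype E]
    [DecidableEq E] {M : Type*} [AddCommMonoid M] (g : V → M) :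
    ∑ e ∈ (backEdges F)ᶜ, g (G.tgt e) = ∑ v ∈ Finset.univ.erase s, g v := by
  have himg : (backEdges F)ᶜ.image G.tgt = Finset.univ.erase s := by
    ext v
    have := Set.ext_iff.1 hF.image_tgt v
    simpa using this
  rw [← himg, Finset.sum_image]
  intro e he f hf
  exact hF.injOn_tgt (by simpa using he) (by simpa using hf)

/-- Tree edges correspond to the vertices other than `s` by their targets. -/
theorem card_add_card_backEdges (hF : G.IsOutTree s F) [Fintype V] [Fintype E] :
    Fintype.card V + (backEdges F).card = Fintype.card E + 1 := by
  classical
  have h := hF.sum_tgt (fun _ => 1)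
  rw [Finset.sum_const, Finset.sum_const, smul_eq_mul, smul_eq_mul, mul_one, mul_one,
    Finset.card_erase_of_mem (Finset.mem_univ s), Finset.card_univ] at h
  have h1 := Finset.card_add_card_compl (backEdges F)
  have : 0 < Fintype.card V := Fintype.card_pos_iff.2 ⟨s⟩
  omega

/-- If every vertex has a single outgoing edge, sums over the edges telescope. -/
theorem sum_sub_telescope [Finite V] [Fintype E] (hsrc : Function.Bijective G.src) (g : ℝ → ℝ) :
    ∑ e, (g (hF.depth (G.src e)) - g (hF.backTime e)) =
      g 0 - ∑ e ∈ backEdges F, g (hF.backTime e) := by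
  classical
  have := Fintype.ofFinite V
  have h : ∑ e, g (hF.backTime e) = ∑ e ∈ backEdges F, g (hF.backTime e) +
      ∑ v ∈ Finset.univ.erase s, g (hF.depth v) := by
    rw [← hF.sum_tgt, ← Finset.sum_add_sum_compl (backEdges F)]
    congr 1
    refine Finset.sum_congr rfl fun e he => ?_
    rw [hF.depth_tgt (by simpa using he)]
  rw [Finset.sum_sub_distrib, hsrc.sum_comp (fun v => g (hF.depth v)), h,
    ← Finset.add_sum_erase Finset.univ (fun v => g (hF.depth v)) (Finset.mem_univ s),
    hF.depth_root]
  ring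

variable [Fintype E] {q : V → PMF E} {Ω : Type*} [MeasurableSpace Ω]
  {μ : Measure Ω} {X : ℕ → Ω → E}

theorem bijective_src (hF : G.IsOutTree s F) [Fintype V] (hX : G.IsRandomWalk s q μ X)
    (hcard : (backEdges F).card = 1) : Function.Bijective G.src := by
  rw [Fintype.bijective_iff_surjective_and_card]
  refine ⟨hX.exists_src_eq, ?_⟩
  have := hF.card_add_card_backEdges
  omega

/-- If there is only one cycle, the motion is deterministic. -/
theorem ncard_endpoints_of_card_eq_one (hF : G.IsOutTree s F) [Fintype V]
    (hb : ∀ e, e ∉ F → G.tgt e = s) (hlen : LinearIndependent ℚ G.len) (hX : G.IsRandomWalk s q μ X)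
    (hcard : (backEdges F).card = 1) {T : ℝ} (hT : 0 ≤ T) :
    ((G.endpoints μ X T).ncard : ℝ) = 1 := by
  classical
  have hsrc := hF.bijective_src hX hcard
  rw [ncard_eq_sum_edgePart hsrc (hF.finite_endpoints hb hX T), Nat.cast_sum]
  simp only [hF.ncard_edgePart_endpoints hb hlen hX]
  rw [hF.sum_sub_telescope hsrc fun x => latticeCount (backEdges F) hF.backTime (T - x), sub_zero]
  obtain ⟨e, he⟩ := Finset.card_eq_one.1 hcard
  have h := latticeCount_insert (s := ∅) (T := T) hF.backTime_pos (Finset.notMem_empty e)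
  rw [latticeCount_empty hT, insert_empty_eq] at h
  rw [he, Finset.sum_singleton, h]
  ring

/-- The asymptotics of the number of endpoints if there is more than one cycle. -/
theorem tendsto_ncard_endpoints_div_pow (hb : ∀ e, e ∉ F → G.tgt e = s)
    (hlen : LinearIndependent ℚ G.len) (hX : G.IsRandomWalk s q μ X)
    (hcard : 1 < (backEdges F).card) :
    Tendsto (fun T : ℝ => ((G.endpoints μ X T).ncard : ℝ) / T ^ ((backEdges F).card - 1)) atTop
      (nhds (1 / (((backEdges F).card - 1)! * ∏ e ∈ backEdges F, hF.backTime e) *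
        ∑ e, G.len e)) := by
  obtain ⟨e₁, he₁, e₂, he₂, hne⟩ := Finset.one_lt_card.1 hcard
  have hinc := tendsto_latticeCount_increment hF.backTime_pos he₁ he₂
    (hF.irrational_backTime_div hlen (mem_backEdges.1 he₁) hne)
  set k := (backEdges F).card - 1 with hk
  set c : ℝ := 1 / ((k)! * ∏ e ∈ backEdges F, hF.backTime e) with hc
  have hsum : Tendsto (fun T : ℝ =>
      ((∑ e, (G.edgePart (G.endpoints μ X T) e).ncard : ℕ) : ℝ) / T ^ k) atTop
      (nhds (c * ∑ e, G.len e)) := by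
    rw [Finset.mul_sum]
    have : ∀ T : ℝ, ((∑ e, (G.edgePart (G.endpoints μ X T) e).ncard : ℕ) : ℝ) / T ^ k =
        ∑ e, ((G.edgePart (G.endpoints μ X T) e).ncard : ℝ) / T ^ k := by
      intro T
      rw [Nat.cast_sum, Finset.sum_div]
    simp only [this]
    refine tendsto_finsetSum _ fun e _ => ?_
    -- Both ends of the window are compared with `L T`; their distance is `len e`.
    have h := (hinc (-hF.depth (G.src e))).sub (hinc (-hF.backTime e))
    rw [show c * -hF.depth (G.src e) - c * -hF.backTime e = c * G.len e by
      rw [backTime]; ring] at h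
    refine h.congr fun T => ?_
    rw [hF.ncard_edgePart_endpoints hb hlen hX, ← sub_div, sub_sub_sub_cancel_right,
      ← sub_eq_add_neg, ← sub_eq_add_neg]
  have hk0 : k ≠ 0 := by omega
  have hconst : Tendsto (fun T : ℝ => (Fintype.card E : ℝ) / T ^ k) atTop (nhds 0) :=
    tendsto_const_nhds.div_atTop (tendsto_pow_atTop hk0)
  have hlow := hsum.sub hconst
  rw [sub_zero] at hlow
  refine tendsto_of_tendsto_of_tendsto_of_le_of_le' hlow hsum ?_ ?_
  · filter_upwards [eventually_gt_atTop 0] with T hT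
    rw [← sub_div]
    refine div_le_div_of_nonneg_right ?_ (by positivity)
    rw [sub_le_iff_le_add]
    exact_mod_cast sum_edgePart_le_ncard_add hX.exists_src_eq (hF.finite_endpoints hb hX T)
  · filter_upwards [eventually_gt_atTop 0] with T hT
    refine div_le_div_of_nonneg_right ?_ (by positivity)
    exact_mod_cast ncard_le_sum_edgePart hX.exists_src_eq _

end IsOutTree

end MetricDigraph

theorem theorem2 {V E : Type*} [Fintype V] [Fintype E] [Nonempty E]
    (G : MetricDigraph V E) (s : V) (hG : G.IsOneWaySperner s)
    (hlen : LinearIndependent ℚ G.len)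
    {Ω : Type*} [MeasurableSpace Ω] (μ : Measure Ω) [IsProbabilityMeasure μ]
    (q : V → PMF E) (X : ℕ → Ω → E) (hX : G.IsRandomWalk s q μ X)
    (β : ℕ) (hβ : β = G.cycleFinset.card) :
    (∀ T : ℝ, (G.endpoints μ X T).Finite) ∧
    (fun T : ℝ => ((G.endpoints μ X T).ncard : ℝ)) ~[atTop]
      fun T : ℝ => T ^ (β - 1) / ((β - 1)! : ℝ) *
        ((∑ e, G.len e) / ∏ c ∈ G.cycleFinset, G.cycleLen c) := by
  classical
  obtain ⟨hconn, F, hF, hb⟩ := hG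
  refine ⟨hF.finite_endpoints hb hX, ?_⟩
  rw [hF.prod_cycleLen hb, hβ, hF.card_cycleFinset hb]
  have hP : 0 < ∏ e ∈ MetricDigraph.backEdges F, hF.backTime e :=
    Finset.prod_pos fun e _ => hF.backTime_pos e
  have hS : 0 < ∑ e, G.len e := Finset.sum_pos (fun e _ => G.len_pos e) Finset.univ_nonempty
  rcases (Nat.succ_le_of_lt (hF.backEdges_nonempty hconn).card_pos).eq_or_lt with h1 | h1
  -- All edges lie on the only cycle: telescoping with `x ↦ -x` yields its length, so the claimed
  -- asymptotic value is the constant 1.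
  · have hsum : ∑ e, G.len e = ∏ e ∈ MetricDigraph.backEdges F, hF.backTime e := by
      have h := hF.sum_sub_telescope (hF.bijective_src hX h1.symm) fun x => -x
      obtain ⟨e, he⟩ := Finset.card_eq_one.1 h1.symm
      simpa [he, MetricDigraph.IsOutTree.backTime] using h
    refine IsEquivalent.congr_left (u := fun _ => (1 : ℝ)) ?_ ?_
    · rw [← h1, hsum, div_self hP.ne']
      simp [IsEquivalent.refl]
    · filter_upwards [eventually_ge_atTop 0] with T hT
      rw [hF.ncard_endpoints_of_card_eq_one hb hlen hX h1.symm hT]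
  · refine isEquivalent_of_tendsto_one ?_
    have h := (hF.tendsto_ncard_endpoints_div_pow hb hlen hX h1).div_const
      (1 / (((MetricDigraph.backEdges F).card - 1)! *
        ∏ e ∈ MetricDigraph.backEdges F, hF.backTime e) * ∑ e, G.len e)
    rw [div_self (by positivity)] at h
    refine h.congr' ?_
    filter_upwards [eventually_gt_atTop 0] with T hT
    simp only [Pi.div_apply]
    field_simp
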